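/- **Setting.** Let $\mathbf{M}$ and $\mathbf{Q}$ be small symmetric monoidal categories with the same objects, let $J:\mathbf{M}\to\mathbf{Q}$ be a strict monoidal functor that is the identity on objects, let $\mathrm{Bit}$ be an object and $\mathrm{zero},\mathrm{one}:I\to\mathrm{Bit}$ morphisms of $\mathbf{M}$ such that $\mathrm{inj}_1=J(\mathrm{zero})$ and $\mathrm{inj}_2=J(\mathrm{one})$ exhibit $\mathrm{Bit}$ as a coproduct $I+I$ in $\mathbf{Q}$, and suppose that the tensor product of $\mathbf{Q}$ distributes over this coproduct. Let $\mathbf{V}$ be the cartesian closed category of bisets: objects are triples $(A_0,A_1,f:A_1\to A_0)$ of two sets and a function, morphisms are commuting squares. Let $\mathbf{C}$ be the $\mathbf{V}$-category with the objects of $\mathbf{M}$ and $\mathbf{C}(A,B)=(\mathbf{Q}(A,B),\mathbf{M}(A,B),J)$. A $\mathbf{V}$-functor $F:\mathbf{C}^{\mathrm{op}}\to\mathbf{V}$ induces a functor $F^0:\mathbf{Q}^{\mathrm{op}}\to\mathbf{Set}$, $F^0A=(FA)_0$; call $F$ smooth if $F^0$ sends every binary coproduct that exists in $\mathbf{Q}$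 to a product of sets. Let $\widetilde{\mathbf{C}}$ be the category of smooth $\mathbf{V}$-functors and $\mathbf{V}$-natural transformations, and let $\overline{y}A=\mathbf{C}(-,A)$ be the Lambek (corestricted Yoneda) embedding. Let $\widetilde{\mathbf{Q}}$ be the full subcategory of $\mathbf{Set}^{\mathbf{Q}^{\mathrm{op}}}$ of the functors that send every binary coproduct existing in $\mathbf{Q}$ to a product, let $L$ be the left adjoint of its inclusion, with unit $u$, and let $\kappa:\mathbf{Q}\to\widetilde{\mathbf{Q}}$, $\kappa A=\mathbf{Q}(-,A)$, be its Lambek embedding. For a $\mathbf{V}$-functor $F:\mathbf{C}^{\mathrm{op}}\to\mathbf{V}$ let $\widetilde{L}F$ be the smooth functor with $(\widetilde{L}F)A=\bigl((LF^0)A,\ (FA)_1,\ (FA)_1\to F^0A\xrightarrow{u}(LF^0)A\bigr)$. Put $\mathrm{Bool}=\widetilde{L}(\overline{y}I+\overline{y}I)$ (the coproduct of two copies of $\overline{y}I$ in $\widetilde{\mathbf{C}}$), with injections $\iota_1,\iota_2:\overline{y}I\to\mathrm{Bool}$, and write $\mathrm{Bit}$ also for $\overline{y}(\mathrm{Bit})\in\widetilde{\mathbf{C}}$.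 Finally, let $\widetilde{T}$ be the monad on $\widetilde{\mathbf{C}}$ with $(\widetilde{T}F)A=((FA)_0,(FA)_0,\mathrm{id})$, whose unit $\eta_F:F\to\widetilde{T}F$ has components $(\mathrm{id},\,(FA)_1\to(FA)_0)$. **Theorem.** The embedding $\kappa:\mathbf{Q}\to\widetilde{\mathbf{Q}}$ preserves the coproduct $\mathrm{Bit}=I+I$. Moreover, there are $\mathbf{V}$-natural transformations $\mathsf{init}:\mathrm{Bool}\to\mathrm{Bit}$ and $\mathsf{Dyn}:\mathrm{Bit}\to\widetilde{T}\,\mathrm{Bool}$ in $\widetilde{\mathbf{C}}$ such that 1. $\mathsf{init}\circ\iota_1=\overline{y}(\mathrm{zero})$ and $\mathsf{init}\circ\iota_2=\overline{y}(\mathrm{one})$, i.e. $\mathsf{init}=[\mathsf{zero},\mathsf{one}]$; 2. $\widetilde{T}\,\mathsf{init}:\widetilde{T}\,\mathrm{Bool}\to\widetilde{T}\,\mathrm{Bit}$ is an isomorphism; 3. $\widetilde{T}\,\mathsf{init}\circ\mathsf{Dyn}=\eta_{\mathrm{Bit}}$, i.e. $\mathsf{Dyn}=(\widetilde{T}\,\mathsf{init})^{-1}\circ\eta_{\mathrm{Bit}}$;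 4. $\mathsf{Dyn}\circ\mathsf{init}=\eta_{\mathrm{Bool}}$. -/

import Mathlib

open CategoryTheory Limits MonoidalCategory Opposite
open scoped MonoidalClosed

universe u

/-! ### The cartesian closed category `V` of bisets -/

/-- A biset is a triple `(A₀, A₁, f : A₁ → A₀)`. -/
structure Biset : Type (u + 1) where
  obj₀ : Type u
  obj₁ : Type u
  str : obj₁ → obj₀

namespace Biset

/-- A morphism of bisets is a commuting square of functions. -/
@[ext]
structure Hom (A B : Biset.{u}) : Type u where
  map₀ : A.obj₀ → B.obj₀
  map₁ : A.obj₁ → B.obj₁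
  comm : ∀ a, B.str (map₁ a) = map₀ (A.str a)

instance : Category.{u} Biset.{u} where
  Hom := Hom
  id A := { map₀ := fun a => a, map₁ := fun a => a, comm := fun _ => rfl }
  comp f g :=
    { map₀ := fun a => g.map₀ (f.map₀ a), map₁ := fun a => g.map₁ (f.map₁ a)
      comm := fun a => by rw [g.comm, f.comm] }

@[ext]
theorem hom_ext {A B : Biset.{u}} {f g : A ⟶ B} (h₀ : ∀ a, f.map₀ a = g.map₀ a)
    (h₁ : ∀ a, f.map₁ a = g.map₁ a) : f = g :=
  Hom.ext (funext h₀) (funext h₁)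

@[simp] theorem id_map₀ (A : Biset.{u}) (a : A.obj₀) : Hom.map₀ (𝟙 A) a = a := rfl

@[simp] theorem id_map₁ (A : Biset.{u}) (a : A.obj₁) : Hom.map₁ (𝟙 A) a = a := rfl

@[simp] theorem comp_map₀ {A B C : Biset.{u}} (f : A ⟶ B) (g : B ⟶ C) (a : A.obj₀) :
    (f ≫ g).map₀ a = g.map₀ (f.map₀ a) := rfl

@[simp] theorem comp_map₁ {A B C : Biset.{u}} (f : A ⟶ B) (g : B ⟶ C) (a : A.obj₁) :
    (f ≫ g).map₁ a = g.map₁ (f.map₁ a) := rfl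

/-- The one-point biset. -/
def unit : Biset.{u} := ⟨PUnit, PUnit, id⟩

/-- The product of bisets, formed levelwise. -/
def prod (A B : Biset.{u}) : Biset.{u} :=
  ⟨A.obj₀ × B.obj₀, A.obj₁ × B.obj₁, fun x => (A.str x.1, B.str x.2)⟩

def terminalCone : LimitCone (Functor.empty.{0} Biset.{u}) where
  cone := asEmptyCone unit
  isLimit := IsTerminal.ofUniqueHom
    (fun _ => { map₀ := fun _ => ⟨⟩, map₁ := fun _ => ⟨⟩, comm := fun _ => rfl })
    (fun _ _ => rfl)

def prodCone (A B : Biset.{u}) : LimitCone (pair A B) where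
  cone := BinaryFan.mk (P := prod A B)
    { map₀ := Prod.fst, map₁ := Prod.fst, comm := fun _ => rfl }
    { map₀ := Prod.snd, map₁ := Prod.snd, comm := fun _ => rfl }
  isLimit := BinaryFan.IsLimit.mk _
    (fun f g =>
      { map₀ := fun x => (f.map₀ x, g.map₀ x), map₁ := fun x => (f.map₁ x, g.map₁ x)
        comm := fun x => Prod.ext (f.comm x) (g.comm x) })
    (fun _ _ => rfl) (fun _ _ => rfl)
    (fun f g m h₁ h₂ => by subst h₁ h₂; rfl)

instance : CartesianMonoidalCategory Biset.{u} :=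
  CartesianMonoidalCategory.ofChosenFiniteProducts terminalCone prodCone

instance : BraidedCategory Biset.{u} := .ofCartesianMonoidalCategory

/-- The exponential `A ⇒ B`, with `(A ⇒ B)₀` the functions `A₀ → B₀` and `(A ⇒ B)₁` the morphisms
of bisets `A ⟶ B`. -/
def exp (A B : Biset.{u}) : Biset.{u} := ⟨A.obj₀ → B.obj₀, A ⟶ B, fun h => h.map₀⟩

def expFunctor (A : Biset.{u}) : Biset.{u} ⥤ Biset.{u} where
  obj := exp A
  map f := { map₀ := fun g a => f.map₀ (g a), map₁ := fun h => h ≫ f, comm := fun _ => rfl }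

def expAdjunction (A : Biset.{u}) : tensorLeft A ⊣ expFunctor A where
  unit :=
    { app := fun Z =>
        { map₀ := fun z a => (a, z)
          map₁ := fun z =>
            { map₀ := fun a => (a, Z.str z), map₁ := fun a => (a, z), comm := fun _ => rfl }
          comm := fun _ => rfl }
      naturality := fun _ _ f => hom_ext (fun _ => rfl)
        (fun a => hom_ext (fun _ => Prod.ext rfl (f.comm a)) (fun _ => rfl)) }
  counit :=
    { app := fun _ =>
        { map₀ := fun x => x.2 x.1
          map₁ := fun x => x.2.map₁ x.1
          comm := fun x => x.2.comm x.1 }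
      naturality := fun _ _ _ => rfl }
  left_triangle_components := fun _ => rfl
  right_triangle_components := fun _ => rfl

/-- Bisets are cartesian closed; hence they are enriched over themselves by
`MonoidalClosed.enrichedCategorySelf`. -/
instance : MonoidalClosed Biset.{u} where
  closed A := { rightAdj := expFunctor A, adj := expAdjunction A }

/-- The category of sets as a trivial biset-enriched category. -/
instance : EnrichedCategory Biset.{u} (Type u) where
  Hom A B := ⟨A → B, A → B, fun f => f⟩
  id _ := { map₀ := fun _ a => a, map₁ := fun _ a => a, comm := fun _ => rfl }
  comp _ _ _ :=
    { map₀ := fun p a => p.2 (p.1 a), map₁ := fun p a => p.2 (p.1 a), comm := fun _ => rfl }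
  id_comp _ _ := rfl
  comp_id _ _ := rfl
  assoc _ _ _ _ := rfl

/-- The `V`-functor `U₀ : V → Set`. -/
def U₀ : EnrichedFunctor Biset.{u} Biset.{u} (Type u) where
  obj A := A.obj₀
  map _ _ := { map₀ := fun f => f, map₁ := fun f => f.map₀, comm := fun _ => rfl }
  map_id _ := rfl
  map_comp _ _ _ := rfl

/-- The `V`-functor `Δ : Set → V`, `Δ X = (X, X, id)`. -/
def Δ : EnrichedFunctor Biset.{u} (Type u) Biset.{u} where
  obj X := ⟨X, X, fun x => x⟩
  map _ _ :=
    { map₀ := fun f => f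
      map₁ := fun f => { map₀ := f, map₁ := f, comm := fun _ => rfl }
      comm := fun _ => rfl }
  map_id _ := rfl
  map_comp _ _ _ := rfl

end Biset

/-! ### Product-preserving presheaves -/

/-- Presheaves of sets on `Q` that turn every binary coproduct existing in `Q` into a product of
sets (binary coproducts of `Q` are the binary products of `Qᵒᵖ`). -/
abbrev prodPreserving (Q : Type u) [SmallCategory Q] : ObjectProperty (Qᵒᵖ ⥤ Type u) :=
  ObjectProperty.preservesLimitsOfShape (Discrete WalkingPair)

/-- Product-preserving presheaves form a reflective subcategory. -/
instance prodPreserving_isRightAdjoint (Q : Type u) [SmallCategory Q] :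
    (prodPreserving Q).ι.IsRightAdjoint := by
  have : Fact Cardinal.aleph0.{u}.IsRegular := Cardinal.fact_isRegular_aleph0
  have hy : ∀ X : Q, IsCardinalPresentable (shrinkYoneda.{u}.obj X) Cardinal.aleph0.{u} :=
    fun X => isCardinalPresentable_of_iso (uliftYonedaIsoShrinkYoneda.{u}.app X) _
  have key : ∀ P : ObjectProperty (Qᵒᵖ ⥤ Type u),
      P = (⨆ (F : Discrete WalkingPair ⥤ Qᵒᵖ),
        MorphismProperty.ofHoms (Presheaf.preservesLimitHomFamily.{u} F)).isLocal →
      P.ι.IsRightAdjoint := by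
    rintro _ rfl
    refine MorphismProperty.isRightAdjoint_ι_isLocal _ Cardinal.aleph0.{u} ?_
    intro X Y f hf
    simp only [MorphismProperty.iSup_iff] at hf
    obtain ⟨F, ⟨h⟩⟩ := hf
    refine ⟨?_, hy _⟩
    have : ∀ k, IsCardinalPresentable ((F.leftOp ⋙ shrinkYoneda.{u}).obj k) Cardinal.aleph0.{u} :=
      fun k => hy _
    refine isCardinalPresentable_of_isColimit _
      (colimit.isColimit (F.leftOp ⋙ shrinkYoneda.{u})) _ ?_
    rw [hasCardinalLT_aleph0_iff]
    infer_instance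
  exact key _ Presheaf.preservesLimitsOfShape_eq_isLocal

/-- The left adjoint `L` of the inclusion of product-preserving presheaves. -/
noncomputable def prodReflector (Q : Type u) [SmallCategory Q] :
    (Qᵒᵖ ⥤ Type u) ⥤ (prodPreserving Q).FullSubcategory :=
  (prodPreserving Q).ι.leftAdjoint

/-- The adjunction between `L` and the inclusion. -/
noncomputable def prodReflectorAdj (Q : Type u) [SmallCategory Q] :
    prodReflector Q ⊣ (prodPreserving Q).ι :=
  Adjunction.ofIsRightAdjoint _

/-- The Lambek embedding `κ : Q → Q̃`, the Yoneda embedding corestricted to the full subcategory of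
product-preserving presheaves. -/
def lambekQ (Q : Type u) [SmallCategory Q] : Q ⥤ (prodPreserving Q).FullSubcategory :=
  (prodPreserving Q).lift yoneda (fun A =>
    (inferInstance : PreservesLimitsOfShape (Discrete WalkingPair) (yoneda.obj A)))

/-! ### Strict monoidal functors -/

/-- A monoidal functor is strict if it preserves the unit and the tensor product on the nose, with
identities as structure morphisms. -/
structure IsStrictMonoidal {M Q : Type u} [SmallCategory M] [SmallCategory Q] [MonoidalCategory M]
    [MonoidalCategory Q] (J : M ⥤ Q) [J.Monoidal] : Prop where
  obj_unit : 𝟙_ Q = J.obj (𝟙_ M)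
  ε_eq : Functor.LaxMonoidal.ε J = eqToHom obj_unit
  obj_tensor : ∀ A B : M, J.obj A ⊗ J.obj B = J.obj (A ⊗ B)
  μ_eq : ∀ A B : M, Functor.LaxMonoidal.μ J A B = eqToHom (obj_tensor A B)

section Model

variable {M Q : Type u} [SmallCategory M] [SmallCategory Q]

/-! ### The `V`-category `C` and its `V`-category of presheaves -/

/-- The category `Q`, with its objects named by those of `M` along `J`. When `J` is the identity (or
just bijective) on objects, this is `Q` itself. -/
abbrev QOb (J : M ⥤ Q) : Type u := InducedCategory Q J.obj

/-- The objects of the `V`-category `C`. -/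
def CCat (_ : M ⥤ Q) : Type u := M

/-- The `V`-category `C`, with `C(A, B) = (Q(A, B), M(A, B), J)`. -/
instance (J : M ⥤ Q) : EnrichedCategory Biset.{u} (CCat J) where
  Hom A B := ⟨J.obj A ⟶ J.obj B, (show M from A) ⟶ (show M from B), fun f => J.map f⟩
  id A := { map₀ := fun _ => 𝟙 (J.obj A), map₁ := fun _ => 𝟙 (show M from A)
            comm := fun _ => J.map_id _ }
  comp _ _ _ :=
    { map₀ := fun p => p.1 ≫ p.2, map₁ := fun p => p.1 ≫ p.2
      comm := fun _ => J.map_comp _ _ }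
  id_comp A B := Biset.hom_ext (fun f => Category.id_comp (X := J.obj A) (Y := J.obj B) f)
    (fun f => Category.id_comp (X := (show M from A)) (Y := (show M from B)) f)
  comp_id A B := Biset.hom_ext (fun f => Category.comp_id (X := J.obj A) (Y := J.obj B) f)
    (fun f => Category.comp_id (X := (show M from A)) (Y := (show M from B)) f)
  assoc A B C D := Biset.hom_ext
    (fun p => (Category.assoc (W := J.obj A) (X := J.obj B) (Y := J.obj C) (Z := J.obj D)
      p.1 p.2.1 p.2.2))
    (fun p => (Category.assoc (W := (show M from A)) (X := (show M from B)) (Y := (show M from C))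
      (Z := (show M from D)) p.1 p.2.1 p.2.2))

/-- The objects of the presheaf category of `C`: the `V`-functors from `Cᵒᵖ` to `V`. -/
structure CBar (J : M ⥤ Q) : Type (u + 1) where
  fn : EnrichedFunctor Biset.{u} (CCat J)ᵒᵖ Biset.{u}

namespace CBar

variable {J : M ⥤ Q}

/-- The biset `F A`. -/
abbrev at' (F : CBar J) (A : M) : Biset.{u} := F.fn.obj (op (show CCat J from A))

/-- The action of a morphism of `Q` on level `0`. -/
def act₀ (F : CBar J) {A B : M} (f : J.obj B ⟶ J.obj A) : (F.at' A).obj₀ → (F.at' B).obj₀ :=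
  (F.fn.map (op (show CCat J from A)) (op (show CCat J from B))).map₀ f

/-- The action of a morphism of `M`. -/
def act₁ (F : CBar J) {A B : M} (f : B ⟶ A) : F.at' A ⟶ F.at' B :=
  (F.fn.map (op (show CCat J from A)) (op (show CCat J from B))).map₁ f

theorem act₁_map₀ (F : CBar J) {A B : M} (f : B ⟶ A) : (F.act₁ f).map₀ = F.act₀ (J.map f) :=
  (F.fn.map (op (show CCat J from A)) (op (show CCat J from B))).comm f

theorem act₀_id (F : CBar J) (A : M) (x : (F.at' A).obj₀) : F.act₀ (𝟙 (J.obj A)) x = x :=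
  congrFun (congrFun (congrArg Biset.Hom.map₀ (F.fn.map_id (op (show CCat J from A)))) ⟨⟩) x

theorem act₀_comp (F : CBar J) {A B C : M} (f : J.obj B ⟶ J.obj A) (g : J.obj C ⟶ J.obj B)
    (x : (F.at' A).obj₀) : F.act₀ (g ≫ f) x = F.act₀ g (F.act₀ f x) :=
  congrFun (congrFun (congrArg Biset.Hom.map₀ (F.fn.map_comp (op (show CCat J from A))
    (op (show CCat J from B)) (op (show CCat J from C)))) (f, g)) x

theorem act₁_id (F : CBar J) (A : M) : F.act₁ (𝟙 A) = 𝟙 (F.at' A) :=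
  congrFun (congrArg Biset.Hom.map₁ (F.fn.map_id (op (show CCat J from A)))) ⟨⟩

theorem act₁_comp (F : CBar J) {A B C : M} (f : B ⟶ A) (g : C ⟶ B) :
    F.act₁ (g ≫ f) = F.act₁ f ≫ F.act₁ g :=
  congrFun (congrArg Biset.Hom.map₁ (F.fn.map_comp (op (show CCat J from A))
    (op (show CCat J from B)) (op (show CCat J from C)))) (f, g)

/-- A `V`-functor `Cᵒᵖ → V` from a family of bisets with actions of `Q` on level `0` and of `M` on
level `1`. -/
def ofActions (obj : M → Biset.{u})
    (a₀ : ∀ {A B : M}, (J.obj B ⟶ J.obj A) → (obj A).obj₀ → (obj B).obj₀)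
    (a₁ : ∀ {A B : M}, (B ⟶ A) → (obj A).obj₁ → (obj B).obj₁)
    (comm : ∀ {A B : M} (f : B ⟶ A) (x : (obj A).obj₁),
      (obj B).str (a₁ f x) = a₀ (J.map f) ((obj A).str x))
    (id₀ : ∀ (A : M) (x : (obj A).obj₀), a₀ (𝟙 (J.obj A)) x = x)
    (id₁ : ∀ (A : M) (x : (obj A).obj₁), a₁ (𝟙 A) x = x)
    (comp₀ : ∀ {A B C : M} (f : J.obj B ⟶ J.obj A) (g : J.obj C ⟶ J.obj B) (x : (obj A).obj₀),
      a₀ (g ≫ f) x = a₀ g (a₀ f x))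
    (comp₁ : ∀ {A B C : M} (f : B ⟶ A) (g : C ⟶ B) (x : (obj A).obj₁),
      a₁ (g ≫ f) x = a₁ g (a₁ f x)) : CBar J where
  fn :=
    { obj := fun A => obj A.unop
      map := fun A B =>
        { map₀ := fun f => a₀ (A := A.unop) (B := B.unop) f
          map₁ := fun f =>
            { map₀ := a₀ (A := A.unop) (B := B.unop) (J.map f)
              map₁ := a₁ (A := A.unop) (B := B.unop) f
              comm := comm (A := A.unop) (B := B.unop) f }
          comm := fun _ => rfl }
      map_id := fun A => Biset.hom_ext (fun _ => funext fun x => id₀ A.unop x)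
        (fun _ => Biset.hom_ext
          (fun x => (congrArg (fun f => a₀ (A := A.unop) (B := A.unop) f x) (J.map_id A.unop)).trans
            (id₀ A.unop x))
          (fun x => id₁ A.unop x))
      map_comp := fun A B C => Biset.hom_ext
        (fun p => funext fun x => comp₀ (A := A.unop) (B := B.unop) (C := C.unop) p.1 p.2 x)
        (fun p => Biset.hom_ext
          (fun x => (congrArg (fun f => a₀ (A := A.unop) (B := C.unop) f x)
            (J.map_comp (X := C.unop) (Y := B.unop) (Z := A.unop) p.2 p.1)).trans
            (comp₀ (A := A.unop) (B := B.unop) (C := C.unop) _ _ x))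
          (fun x => comp₁ (A := A.unop) (B := B.unop) (C := C.unop) p.1 p.2 x)) }

/-- A `V`-natural transformation `F → G`: a family of morphisms `F A ⟶ G A` in `V` such that the two
composites `Cᵒᵖ(A, B) ⟶ (F A ⇒ F B) ⟶ (F A ⇒ G B)` and
`Cᵒᵖ(A, B) ⟶ (G A ⇒ G B) ⟶ (F A ⇒ G B)` in `V` agree. -/
@[ext]
structure VNatTrans (F G : CBar J) : Type u where
  app : ∀ A : (CCat J)ᵒᵖ, F.fn.obj A ⟶ G.fn.obj A
  naturality : ∀ A B : (CCat J)ᵒᵖ,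
    F.fn.map A B ≫ (ihom (F.fn.obj A)).map (app B) =
      G.fn.map A B ≫ (MonoidalClosed.pre (app A)).app (G.fn.obj B)

/-- The (underlying ordinary) presheaf category of `C`, with `V`-natural transformations as
morphisms. -/
instance : Category.{u} (CBar J) where
  Hom := VNatTrans
  id F :=
    { app := fun A => 𝟙 _
      naturality := fun A B => by simp }
  comp f g :=
    { app := fun A => f.app A ≫ g.app A
      naturality := fun A B => by
        have h := g.naturality A B
        have h' := f.naturality A B
        simp only [Functor.map_comp, MonoidalClosed.pre_map, NatTrans.comp_app]
        rw [reassoc_of% h', ← reassoc_of% h, NatTrans.naturality] }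

@[ext]
theorem hom_ext {F G : CBar J} {f g : F ⟶ G} (h : ∀ A, f.app A = g.app A) : f = g :=
  VNatTrans.ext (funext h)

@[simp] theorem id_app (F : CBar J) (A : (CCat J)ᵒᵖ) : VNatTrans.app (𝟙 F) A = 𝟙 _ := rfl

@[simp] theorem comp_app {F G H : CBar J} (f : F ⟶ G) (g : G ⟶ H) (A : (CCat J)ᵒᵖ) :
    (f ≫ g).app A = f.app A ≫ g.app A := rfl

/-- `V`-naturality is naturality in the morphisms of `Q` on level `0` and in those of `M` on
level `1`. -/
def homOfNatural {F G : CBar J} (app : ∀ A : M, F.at' A ⟶ G.at' A)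
    (h₀ : ∀ {A B : M} (f : J.obj B ⟶ J.obj A) (x : (F.at' A).obj₀),
      (app B).map₀ (F.act₀ f x) = G.act₀ f ((app A).map₀ x))
    (h₁ : ∀ {A B : M} (f : B ⟶ A) (x : (F.at' A).obj₁),
      (app B).map₁ ((F.act₁ f).map₁ x) = (G.act₁ f).map₁ ((app A).map₁ x)) : F ⟶ G where
  app := fun A => app A.unop
  naturality := fun A B => Biset.hom_ext
    (fun f => funext fun x => h₀ (A := A.unop) (B := B.unop) f x)
    (fun f => Biset.hom_ext
      (fun x => (congrArg (app B.unop).map₀ (congrFun (F.act₁_map₀ (A := A.unop) (B := B.unop) f)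
        x)).trans ((h₀ (A := A.unop) (B := B.unop) (J.map f) x).trans
          (congrFun (G.act₁_map₀ (A := A.unop) (B := B.unop) f) ((app A.unop).map₀ x)).symm))
      (fun x => h₁ (A := A.unop) (B := B.unop) f x))

/-- The ordinary presheaf `F⁰` on `Q`, `F⁰ A = (F A)₀`. -/
def zeroPart (F : CBar J) : (QOb J)ᵒᵖ ⥤ Type u where
  obj A := (F.at' A.unop).obj₀
  map {A B} f := TypeCat.ofHom (F.act₀ (A := A.unop) (B := B.unop) f.unop.hom)
  map_id A := by
    ext x
    exact F.act₀_id _ x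
  map_comp f g := by
    ext x
    exact F.act₀_comp _ _ x

/-- The pointwise coproduct `F + G`. -/
def coprod (F G : CBar J) : CBar J :=
  ofActions (fun A => ⟨(F.at' A).obj₀ ⊕ (G.at' A).obj₀, (F.at' A).obj₁ ⊕ (G.at' A).obj₁,
      Sum.map (F.at' A).str (G.at' A).str⟩)
    (fun f => Sum.map (F.act₀ f) (G.act₀ f))
    (fun f => Sum.map (F.act₁ f).map₁ (G.act₁ f).map₁)
    (by
      rintro A B f (x | x)
      · exact congrArg Sum.inl (((F.act₁ f).comm x).trans (congrFun (F.act₁_map₀ f) _))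
      · exact congrArg Sum.inr (((G.act₁ f).comm x).trans (congrFun (G.act₁_map₀ f) _)))
    (by rintro A (x | x) <;> simp [act₀_id])
    (by rintro A (x | x) <;> simp [act₁_id])
    (by rintro A B C f g (x | x) <;> simp [act₀_comp])
    (by rintro A B C f g (x | x) <;> simp [act₁_comp])

def coprodInl (F G : CBar J) : F ⟶ coprod F G :=
  homOfNatural
    (fun _ => { map₀ := Sum.inl, map₁ := Sum.inl, comm := fun _ => rfl })
    (fun _ _ => rfl) (fun _ _ => rfl)

def coprodInr (F G : CBar J) : G ⟶ coprod F G :=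
  homOfNatural
    (fun _ => { map₀ := Sum.inr, map₁ := Sum.inr, comm := fun _ => rfl })
    (fun _ _ => rfl) (fun _ _ => rfl)

/-- The `V`-enriched Yoneda embedding `y A = C(-, A)`, on objects. -/
def yonedaObj (J : M ⥤ Q) (A : M) : CBar J :=
  ofActions (fun X => EnrichedCategory.Hom (show CCat J from X) (show CCat J from A))
    (fun {X Y} (f : J.obj Y ⟶ J.obj X) (g : J.obj X ⟶ J.obj A) => f ≫ g)
    (fun {X Y} (f : Y ⟶ X) (g : X ⟶ A) => f ≫ g)
    (fun f g => J.map_comp f g)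
    (fun X (g : J.obj X ⟶ J.obj A) => Category.id_comp g)
    (fun X (g : X ⟶ A) => Category.id_comp g)
    (fun f g (h : _ ⟶ J.obj A) => Category.assoc g f h)
    (fun f g (h : _ ⟶ A) => Category.assoc g f h)

/-- The Yoneda embedding as an ordinary functor on the underlying category of `C`, which is `M`. -/
def yoneda (J : M ⥤ Q) : M ⥤ CBar J where
  obj := yonedaObj J
  map {A B} f := homOfNatural
    (fun X =>
      { map₀ := fun (g : J.obj X ⟶ J.obj A) => g ≫ J.map f
        map₁ := fun (g : X ⟶ A) => g ≫ f
        comm := fun g => J.map_comp g f })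
    (fun g (h : _ ⟶ J.obj A) => Category.assoc g h (J.map f))
    (fun g (h : _ ⟶ A) => Category.assoc g h f)
  map_id A := hom_ext fun X => Biset.hom_ext
    (fun (g : _ ⟶ J.obj A) => by
      change g ≫ J.map (𝟙 A) = g
      simp)
    (fun (g : _ ⟶ A) => Category.comp_id g)
  map_comp {A B C} f g := hom_ext fun X => Biset.hom_ext
    (fun (h : _ ⟶ J.obj A) => by
      change h ≫ J.map (f ≫ g) = (h ≫ J.map f) ≫ J.map g
      simp)
    (fun (h : _ ⟶ A) => (Category.assoc h f g).symm)

/-- The monad `T` on presheaves on objects: composition with the `V`-functor `Δ ∘ U₀`. -/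
def tObj (F : CBar J) : CBar J := ⟨(F.fn.comp Biset Biset.U₀).comp Biset Biset.Δ⟩

/-- The action of `T` on `V`-natural transformations. -/
def tMap {F G : CBar J} (f : F ⟶ G) : tObj F ⟶ tObj G where
  app A := (Biset.Δ.map _ _).map₁ ((Biset.U₀.map _ _).map₁ (f.app A))
  naturality A B := Biset.hom_ext
    (fun g => congrFun (congrArg Biset.Hom.map₀ (f.naturality A B)) g)
    (fun g => Biset.hom_ext
      (fun x => congrFun (congrArg Biset.Hom.map₀
        (congrFun (congrArg Biset.Hom.map₁ (f.naturality A B)) g)) x)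
      (fun x => congrFun (congrArg Biset.Hom.map₀
        (congrFun (congrArg Biset.Hom.map₁ (f.naturality A B)) g)) x))

/-- The unit `η : F → T F`, given by `(id, str) : F A ⟶ Δ (U₀ (F A))`. -/
def tUnit (F : CBar J) : F ⟶ tObj F :=
  homOfNatural
    (fun A => { map₀ := fun x => x, map₁ := (F.at' A).str, comm := fun _ => rfl })
    (fun _ _ => rfl) (fun f x => (F.act₁ f).comm x)

/-- The multiplication `μ : T (T F) → T F`; each component is the identity. -/
def tMul (F : CBar J) : tObj (tObj F) ⟶ tObj F :=
  homOfNatural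
    (fun _ => { map₀ := fun x => x, map₁ := fun x => x, comm := fun _ => rfl })
    (fun _ _ => rfl) (fun _ _ => rfl)

/-- The presheaf `L̃ F`, with `(L̃ F) A = ((L F⁰) A, (F A)₁, η ∘ str)`, where `L` is the left adjoint
of the inclusion of product-preserving presheaves on `Q` and `η` is the unit of this adjunction. -/
noncomputable def reflectObj (F : CBar J) : CBar J :=
  ofActions
    (fun A => ⟨((prodReflector (QOb J)).obj F.zeroPart).obj.obj (op A), (F.at' A).obj₁,
      fun x => ((prodReflectorAdj (QOb J)).unit.app F.zeroPart).app (op A) ((F.at' A).str x)⟩)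
    (fun {A B} f x => ((prodReflector (QOb J)).obj F.zeroPart).obj.map
      (Quiver.Hom.op (X := (show QOb J from B)) (Y := (show QOb J from A))
        (InducedCategory.homMk f)) x)
    (fun f => (F.act₁ f).map₁)
    (by
      intro A B f x
      have h := ConcreteCategory.congr_hom
        (((prodReflectorAdj (QOb J)).unit.app F.zeroPart).naturality
          (Quiver.Hom.op (X := (show QOb J from B)) (Y := (show QOb J from A))
            (InducedCategory.homMk (J.map f)))) ((F.at' A).str x)
      have h' : (F.at' B).str ((F.act₁ f).map₁ x) = F.act₀ (J.map f) ((F.at' A).str x) :=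
        ((F.act₁ f).comm x).trans (congrFun (F.act₁_map₀ f) _)
      exact (congrArg (fun z => ((prodReflectorAdj (QOb J)).unit.app F.zeroPart).app (op B) z)
        h').trans h)
    (by
      intro A x
      exact ConcreteCategory.congr_hom
        (((prodReflector (QOb J)).obj F.zeroPart).obj.map_id (op (show QOb J from A))) x)
    (by intro A x; rw [act₁_id]; rfl)
    (by
      intro A B C f g x
      exact ConcreteCategory.congr_hom
        (((prodReflector (QOb J)).obj F.zeroPart).obj.map_comp
          (Quiver.Hom.op (X := (show QOb J from B)) (Y := (show QOb J from A))
            (InducedCategory.homMk f))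
          (Quiver.Hom.op (X := (show QOb J from C)) (Y := (show QOb J from B))
            (InducedCategory.homMk g))) x)
    (by intro A B C f g x; rw [act₁_comp]; rfl)

/-- The unit `F → L̃ F` of the reflection. -/
noncomputable def reflectUnit (F : CBar J) : F ⟶ reflectObj F :=
  homOfNatural
    (fun A =>
      { map₀ := fun x => ((prodReflectorAdj (QOb J)).unit.app F.zeroPart).app (op A) x
        map₁ := fun x => x
        comm := fun _ => rfl })
    (by
      intro A B f x
      exact ConcreteCategory.congr_hom
        (((prodReflectorAdj (QOb J)).unit.app F.zeroPart).naturality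
          (Quiver.Hom.op (X := (show QOb J from B)) (Y := (show QOb J from A))
            (InducedCategory.homMk f))) x)
    (fun _ _ => rfl)

end CBar

/-! ### The reflective subcategory of smooth functors -/

/-- A `V`-functor `F : Cᵒᵖ → V` is smooth if `F⁰ : Qᵒᵖ → Set` preserves binary products. -/
def smooth (J : M ⥤ Q) : ObjectProperty (CBar J) := fun F => prodPreserving (QOb J) F.zeroPart

/-- The category `C̃` of smooth functors. -/
abbrev CTilde (J : M ⥤ Q) : Type (u + 1) := (smooth J).FullSubcategory

theorem smooth_yoneda (J : M ⥤ Q) (A : M) : smooth J ((CBar.yoneda J).obj A) := by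
  have e : CategoryTheory.yoneda.obj (show QOb J from A) ≅ ((CBar.yoneda J).obj A).zeroPart :=
    NatIso.ofComponents
      (fun X => (InducedCategory.homEquiv (X := X.unop) (Y := (show QOb J from A))).toIso)
      (fun f => rfl)
  exact preservesLimitsOfShape_of_natIso e

theorem smooth_tObj {J : M ⥤ Q} {F : CBar J} (h : smooth J F) : smooth J F.tObj := h

theorem smooth_reflectObj {J : M ⥤ Q} (F : CBar J) : smooth J F.reflectObj :=
  ((prodReflector (QOb J)).obj F.zeroPart).property

namespace CTilde

/-- The Lambek embedding `ȳ`, on the underlying category `M` of `C`. -/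
def lambek (J : M ⥤ Q) : M ⥤ CTilde J :=
  (smooth J).lift (CBar.yoneda J) (smooth_yoneda J)

/-- The monad `T̃` on `C̃`, the restriction of `T` to smooth functors. -/
def T (J : M ⥤ Q) : Monad (CTilde J) where
  obj F := ⟨F.obj.tObj, smooth_tObj F.property⟩
  map f := ObjectProperty.homMk (CBar.tMap f.hom)
  map_id _ := rfl
  map_comp _ _ := rfl
  η := { app := fun F => ObjectProperty.homMk F.obj.tUnit
         naturality := fun _ _ f => ObjectProperty.hom_ext _ (CBar.hom_ext fun A =>
           Biset.hom_ext (fun _ => rfl) (fun x => (f.hom.app A).comm x)) }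
  μ := { app := fun F => ObjectProperty.homMk F.obj.tMul
         naturality := fun _ _ _ => rfl }
  assoc _ := rfl
  left_unit _ := rfl
  right_unit _ := rfl

/-- The coproduct `F +' G = L̃ (F + G)` in `C̃`. -/
noncomputable def coprod {J : M ⥤ Q} (F G : CTilde J) : CTilde J :=
  ⟨(F.obj.coprod G.obj).reflectObj, smooth_reflectObj _⟩

/-- The left injection into the coproduct. -/
noncomputable def inl {J : M ⥤ Q} (F G : CTilde J) : F ⟶ coprod F G :=
  ObjectProperty.homMk (CBar.coprodInl F.obj G.obj ≫ CBar.reflectUnit _)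

/-- The right injection into the coproduct. -/
noncomputable def inr {J : M ⥤ Q} (F G : CTilde J) : G ⟶ coprod F G :=
  ObjectProperty.homMk (CBar.coprodInr F.obj G.obj ≫ CBar.reflectUnit _)

/-- `Bool = ȳI +' ȳI`. -/
noncomputable def bool (J : M ⥤ Q) [MonoidalCategory M] : CTilde J :=
  coprod ((lambek J).obj (𝟙_ M)) ((lambek J).obj (𝟙_ M))

end CTilde

end Model

/-! The theorem combines the Yoneda lemma on level `0` with the fact that the monad `T̃` sees only
level `0`.

Let `C` be a coproduct of `A` and `B` in `Q`, and let `G` be a presheaf turning it into a product.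
By Yoneda, maps from the representable of `C` to `G` are elements of `G C`, hence pairs of elements
of `G A` and `G B`, hence pairs of maps from the representables of `A` and `B`
(`existsUnique_yoneda_hom`). This is the preservation of the coproduct by `κ`.

Now take `init` to be the copairing of `ȳ(zero)` and `ȳ(one)`. Its level `0` compares `L` of a sum
of two representables with the representable of `Bit`. Both are universal among product-preserving
presheaves under that sum, the second by the previous paragraph, so level `0` of `init` is
invertible (`exists_inverse_tMap_reflectDesc`). Level `1` need not be, since `Bit` is not assumed to
be a coproduct in `M`; but `T̃` replaces level `1` by level `0`, so `T̃ init` is invertible. `Dyn`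
is then `η` followed by this inverse, and the last equation is naturality of `η` at `init`
(`exists_inverse_up_to_unit`). -/

/-! ### Binary coproducts and product-preserving presheaves -/

section Presheaf

variable {D : Type u} [SmallCategory D]

/-- A product-preserving presheaf turns a binary coproduct into a product of sets, elementwise. -/
theorem existsUnique_of_prodPreserving {G : Dᵒᵖ ⥤ Type u} (hG : prodPreserving D G) {A B C : D}
    {i : A ⟶ C} {j : B ⟶ C} (h : IsColimit (BinaryCofan.mk i j))
    (x : G.obj (op A)) (y : G.obj (op B)) :
    ∃! z : G.obj (op C), G.map i.op z = x ∧ G.map j.op z = y := by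
  have : PreservesLimitsOfShape (Discrete WalkingPair) G := hG
  have hl : IsLimit (BinaryFan.mk (G.map i.op) (G.map j.op)) :=
    mapIsLimitOfPreservesOfIsLimit G i.op j.op (BinaryCofan.IsColimit.op h)
  -- Elements are treated as maps from a point, so that the universal property of the limit yields
  -- an element and its uniqueness.
  let f : PUnit.{u + 1} ⟶ G.obj (op A) := TypeCat.ofHom fun _ => x
  let g : PUnit.{u + 1} ⟶ G.obj (op B) := TypeCat.ofHom fun _ => y
  obtain ⟨l, hl₁, hl₂⟩ := BinaryFan.IsLimit.lift' hl f g
  refine ⟨l ⟨⟩, ⟨ConcreteCategory.congr_hom hl₁ ⟨⟩, ConcreteCategory.congr_hom hl₂ ⟨⟩⟩, ?_⟩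
  rintro z ⟨h₁, h₂⟩
  let m : PUnit.{u + 1} ⟶ G.obj (op C) := TypeCat.ofHom fun _ => z
  have hm : m = l := by
    refine BinaryFan.IsLimit.hom_ext hl ?_ ?_
    · rw [hl₁]; ext; exact h₁
    · rw [hl₂]; ext; exact h₂
  exact ConcreteCategory.congr_hom hm ⟨⟩

/-- Morphisms from `yoneda C` to a product-preserving presheaf, for `C` a coproduct of `A` and `B`,
are pairs of morphisms from `yoneda A` and `yoneda B`. -/
theorem existsUnique_yoneda_hom {G : Dᵒᵖ ⥤ Type u} (hG : prodPreserving D G) {A B C : D}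
    {i : A ⟶ C} {j : B ⟶ C} (h : IsColimit (BinaryCofan.mk i j))
    (f : yoneda.obj A ⟶ G) (g : yoneda.obj B ⟶ G) :
    ∃! m : yoneda.obj C ⟶ G, yoneda.map i ≫ m = f ∧ yoneda.map j ≫ m = g := by
  -- Under Yoneda, restriction along `k` becomes the action of `G` on elements, which reduces the
  -- claim to `existsUnique_of_prodPreserving`.
  have comp_iff : ∀ {X : D} (k : X ⟶ C) (m : yoneda.obj C ⟶ G) (f : yoneda.obj X ⟶ G),
      yoneda.map k ≫ m = f ↔ G.map k.op (yonedaEquiv m) = yonedaEquiv f := by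
    intro X k m f
    rw [yonedaEquiv_naturality, EmbeddingLike.apply_eq_iff_eq]
  simp only [comp_iff]
  obtain ⟨z, hz, huniq⟩ := existsUnique_of_prodPreserving hG h (yonedaEquiv f) (yonedaEquiv g)
  refine ⟨yonedaEquiv.symm z, by simpa using hz, fun m hm => ?_⟩
  rw [Equiv.eq_symm_apply]
  exact huniq _ hm

/-- The Lambek embedding preserves binary coproducts. -/
theorem nonempty_isColimit_lambekQ {A B C : D} {i : A ⟶ C} {j : B ⟶ C}
    (h : IsColimit (BinaryCofan.mk i j)) :
    Nonempty (IsColimit (BinaryCofan.mk ((lambekQ D).map i) ((lambekQ D).map j))) := by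
  -- Since the subcategory is full, the universal property against product-preserving presheaves is
  -- exactly the one required.
  have key : ∀ {G : (prodPreserving D).FullSubcategory} (f : (lambekQ D).obj A ⟶ G)
      (g : (lambekQ D).obj B ⟶ G), ∃! m : (lambekQ D).obj C ⟶ G,
        (lambekQ D).map i ≫ m = f ∧ (lambekQ D).map j ≫ m = g := by
    intro G f g
    obtain ⟨m, ⟨h₁, h₂⟩, huniq⟩ := existsUnique_yoneda_hom G.property h f.hom g.hom
    refine ⟨ObjectProperty.homMk m, ⟨ObjectProperty.hom_ext _ h₁, ObjectProperty.hom_ext _ h₂⟩, ?_⟩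
    rintro n ⟨hn₁, hn₂⟩
    exact ObjectProperty.hom_ext _ (huniq n.hom
      ⟨congrArg (fun t => t.hom) hn₁, congrArg (fun t => t.hom) hn₂⟩)
  exact ⟨BinaryCofan.IsColimit.mk _ (fun f g => (key f g).choose)
    (fun f g => (key f g).choose_spec.1.1) (fun f g => (key f g).choose_spec.1.2)
    (fun f g m h₁ h₂ => (key f g).choose_spec.2 m ⟨h₁, h₂⟩)⟩

/-- Restriction along the unit `F → L F` is injective on morphisms to product-preserving
presheaves. -/
theorem prodReflector_hom_ext {F G : Dᵒᵖ ⥤ Type u} (hG : prodPreserving D G)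
    {φ ψ : ((prodReflector D).obj F).obj ⟶ G}
    (h : (prodReflectorAdj D).unit.app F ≫ φ = (prodReflectorAdj D).unit.app F ≫ ψ) : φ = ψ := by
  let φ' : (prodReflector D).obj F ⟶ ⟨G, hG⟩ := ObjectProperty.homMk φ
  let ψ' : (prodReflector D).obj F ⟶ ⟨G, hG⟩ := ObjectProperty.homMk ψ
  have h' : φ' = ψ' := by
    -- Transposing along the adjunction is precomposition with the unit.
    refine ((prodReflectorAdj D).homEquiv _ _).injective ?_
    rw [Adjunction.homEquiv_unit, Adjunction.homEquiv_unit]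
    exact h
  exact congrArg (fun t => t.hom) h'

/-- The extension of a morphism to a product-preserving presheaf along the unit `F → L F`. -/
noncomputable def prodReflectorDesc {F G : Dᵒᵖ ⥤ Type u} (hG : prodPreserving D G) (φ : F ⟶ G) :
    ((prodReflector D).obj F).obj ⟶ G :=
  (((prodReflectorAdj D).homEquiv F ⟨G, hG⟩).symm φ).hom

theorem unit_comp_prodReflectorDesc {F G : Dᵒᵖ ⥤ Type u} (hG : prodPreserving D G) (φ : F ⟶ G) :
    (prodReflectorAdj D).unit.app F ≫ prodReflectorDesc hG φ = φ :=
  (Adjunction.homEquiv_unit (prodReflectorAdj D) F ⟨G, hG⟩ _).symm.trans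
    (Equiv.apply_symm_apply _ _)

end Presheaf

/-! ### Level `0` of `V`-natural transformations, and extension along the reflection. -/

section Model

variable {M Q : Type u} [SmallCategory M] [SmallCategory Q]

namespace CBar

variable {J : M ⥤ Q}

/-- `V`-naturality is an equation of maps into an exponential biset; reading its level `0` at `g`
gives naturality over all of `Q`, not only over the image of `J`. -/
theorem app_act₀ {F G : CBar J} (f : F ⟶ G) {A B : M} (g : J.obj B ⟶ J.obj A)
    (x : (F.at' A).obj₀) :
    (f.app (op (show CCat J from B))).map₀ (F.act₀ g x) =
      G.act₀ g ((f.app (op (show CCat J from A))).map₀ x) :=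
  congrFun (congrFun (congrArg Biset.Hom.map₀
    (f.naturality (op (show CCat J from A)) (op (show CCat J from B)))) g) x

theorem app_act₁ {F G : CBar J} (f : F ⟶ G) {A B : M} (g : B ⟶ A) (x : (F.at' A).obj₁) :
    (f.app (op (show CCat J from B))).map₁ ((F.act₁ g).map₁ x) =
      (G.act₁ g).map₁ ((f.app (op (show CCat J from A))).map₁ x) :=
  congrFun (congrArg Biset.Hom.map₁ (congrFun (congrArg Biset.Hom.map₁
    (f.naturality (op (show CCat J from A)) (op (show CCat J from B)))) g)) x

/-- The natural transformation `F⁰ → G⁰` induced by a `V`-natural transformation `F → G`. -/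
def zeroMap {F G : CBar J} (f : F ⟶ G) : F.zeroPart ⟶ G.zeroPart where
  app A := TypeCat.ofHom (f.app (op (show CCat J from A.unop))).map₀
  naturality A B g := by
    ext x
    exact app_act₀ f (A := A.unop) (B := B.unop) g.unop.hom x

/-- The `V`-natural transformation `T F → T G` induced by a natural transformation `F⁰ → G⁰`. -/
def tMapOfZero {F G : CBar J} (φ : F.zeroPart ⟶ G.zeroPart) : tObj F ⟶ tObj G :=
  have h : ∀ {A B : M} (f : J.obj B ⟶ J.obj A) (x : (F.at' A).obj₀),
      φ.app (op (show QOb J from B)) (F.act₀ f x) =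
        G.act₀ f (φ.app (op (show QOb J from A)) x) := fun {A B} f x =>
    ConcreteCategory.congr_hom (φ.naturality
      (Quiver.Hom.op (X := (show QOb J from B)) (Y := (show QOb J from A))
        (InducedCategory.homMk f))) x
  homOfNatural
    (fun A =>
      { map₀ := fun x => φ.app (op (show QOb J from A)) x
        map₁ := fun x => φ.app (op (show QOb J from A)) x
        comm := fun _ => rfl })
    (fun f x => h f x)
    -- On level `1` of `T F`, a morphism `f` of `M` acts through level `0` of `F.act₁ f`, which is
    -- the action of `J.map f`; so naturality over `Q` suffices.
    (fun {A B} f x => by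
      have hF := congrFun (F.act₁_map₀ f) x
      have hG := congrFun (G.act₁_map₀ f) (φ.app (op (show QOb J from A)) x)
      exact (congrArg (fun z => φ.app (op (show QOb J from B)) z) hF).trans
        ((h (J.map f) x).trans hG.symm))

/-- Both levels of `T F` are `F⁰`, so a single elementwise identity settles both. -/
theorem tMap_comp_tMapOfZero {F G : CBar J} (f : F ⟶ G) (φ : G.zeroPart ⟶ F.zeroPart)
    (h : zeroMap f ≫ φ = 𝟙 _) : tMap f ≫ tMapOfZero φ = 𝟙 _ :=
  have key : ∀ (A : (CCat J)ᵒᵖ) (x : (F.fn.obj A).obj₀),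
      φ.app (op (show QOb J from A.unop)) ((f.app A).map₀ x) = x := fun A x =>
    ConcreteCategory.congr_hom (NatTrans.congr_app h (op (show QOb J from A.unop))) x
  hom_ext fun A => Biset.hom_ext (key A) (key A)

theorem tMapOfZero_comp_tMap {F G : CBar J} (f : F ⟶ G) (φ : G.zeroPart ⟶ F.zeroPart)
    (h : φ ≫ zeroMap f = 𝟙 _) : tMapOfZero φ ≫ tMap f = 𝟙 _ :=
  have key : ∀ (A : (CCat J)ᵒᵖ) (x : (G.fn.obj A).obj₀),
      (f.app A).map₀ (φ.app (op (show QOb J from A.unop)) x) = x := fun A x =>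
    ConcreteCategory.congr_hom (NatTrans.congr_app h (op (show QOb J from A.unop))) x
  hom_ext fun A => Biset.hom_ext (key A) (key A)

/-- The copairing `F + G → H`. -/
def coprodDesc {F G H : CBar J} (f : F ⟶ H) (g : G ⟶ H) : CBar.coprod F G ⟶ H :=
  homOfNatural
    (fun A =>
      { map₀ := Sum.elim (f.app (op (show CCat J from A))).map₀
          (g.app (op (show CCat J from A))).map₀
        map₁ := Sum.elim (f.app (op (show CCat J from A))).map₁
          (g.app (op (show CCat J from A))).map₁
        comm := by
          rintro (x | x)
          · exact (f.app (op (show CCat J from A))).comm x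
          · exact (g.app (op (show CCat J from A))).comm x })
    (by
      rintro A B k (x | x)
      · exact app_act₀ f k x
      · exact app_act₀ g k x)
    (by
      rintro A B k (x | x)
      · exact app_act₁ f k x
      · exact app_act₁ g k x)

/-- Natural transformations out of `(F + G)⁰` are determined by their restrictions. -/
theorem coprod_zeroPart_hom_ext {F G : CBar J} {P : (QOb J)ᵒᵖ ⥤ Type u}
    {φ ψ : (CBar.coprod F G).zeroPart ⟶ P}
    (hl : zeroMap (coprodInl F G) ≫ φ = zeroMap (coprodInl F G) ≫ ψ)
    (hr : zeroMap (coprodInr F G) ≫ φ = zeroMap (coprodInr F G) ≫ ψ) : φ = ψ := by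
  ext A x
  obtain (x | x) := x
  · exact ConcreteCategory.congr_hom (NatTrans.congr_app hl A) x
  · exact ConcreteCategory.congr_hom (NatTrans.congr_app hr A) x

/-- The extension of `F → G` along the unit `F → L̃ F`, for `G` smooth. -/
noncomputable def reflectDesc {F G : CBar J} (hG : smooth J G) (f : F ⟶ G) : reflectObj F ⟶ G :=
  homOfNatural
    (fun A =>
      { map₀ := fun x => (prodReflectorDesc hG (zeroMap f)).app (op (show QOb J from A)) x
        map₁ := (f.app (op (show CCat J from A))).map₁
        -- The structure map of `L̃ F` is that of `F` followed by the unit; the extension cancels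
        -- the unit, leaving the square of `f`.
        comm := fun x => ((f.app (op (show CCat J from A))).comm x).trans
          (ConcreteCategory.congr_hom (NatTrans.congr_app (unit_comp_prodReflectorDesc hG (zeroMap f))
            (op (show QOb J from A))) ((F.at' A).str x)).symm })
    (fun {A B} k x => ConcreteCategory.congr_hom ((prodReflectorDesc hG (zeroMap f)).naturality
      (Quiver.Hom.op (X := (show QOb J from B)) (Y := (show QOb J from A))
        (InducedCategory.homMk k))) x)
    (fun k x => app_act₁ f k x)

theorem reflectUnit_desc {F G : CBar J} (hG : smooth J G) (f : F ⟶ G) :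
    reflectUnit F ≫ reflectDesc hG f = f :=
  hom_ext fun A => Biset.hom_ext
    (fun x => ConcreteCategory.congr_hom (NatTrans.congr_app (unit_comp_prodReflectorDesc hG (zeroMap f))
      (op (show QOb J from A.unop))) x)
    (fun _ => rfl)

/-- Let `G` be smooth, and let `f : F → G` be such that composition with `f⁰` is a bijection
`(G⁰ → P) ≃ (F⁰ → P)` for every product-preserving `P`. Then `T` inverts the extension
`L̃ F → G` of `f`. -/
theorem exists_inverse_tMap_reflectDesc {F G : CBar J} (hG : smooth J G) (f : F ⟶ G)
    (H : ∀ {P : (QOb J)ᵒᵖ ⥤ Type u}, prodPreserving (QOb J) P → ∀ φ : F.zeroPart ⟶ P,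
      ∃! ψ : G.zeroPart ⟶ P, zeroMap f ≫ ψ = φ) :
    ∃ k : tObj G ⟶ tObj (reflectObj F),
      tMap (reflectDesc hG f) ≫ k = 𝟙 _ ∧ k ≫ tMap (reflectDesc hG f) = 𝟙 _ := by
  let R := (prodReflector (QOb J)).obj F.zeroPart
  let η : F.zeroPart ⟶ R.obj := (prodReflectorAdj (QOb J)).unit.app F.zeroPart
  -- The unit `η` and `f⁰` are both universal maps from `F⁰` to product-preserving presheaves. `ψ`
  -- factors `η` through `f⁰`, and the two uniqueness properties make it inverse to the extension of
  -- `f⁰`.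
  obtain ⟨ψ, hψ, -⟩ := H R.property η
  have hη := unit_comp_prodReflectorDesc hG (zeroMap f)
  have h₁ : prodReflectorDesc hG (zeroMap f) ≫ ψ = 𝟙 R.obj :=
    prodReflector_hom_ext R.property
      ((Category.assoc _ _ _).symm.trans ((congrArg (· ≫ ψ) hη).trans
        (hψ.trans (Category.comp_id _).symm)))
  have h₂ : ψ ≫ prodReflectorDesc hG (zeroMap f) = 𝟙 _ :=
    (H hG (zeroMap f)).unique
      ((Category.assoc _ _ _).symm.trans
        ((congrArg (· ≫ prodReflectorDesc hG (zeroMap f)) hψ).trans hη))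
      (Category.comp_id _)
  exact ⟨tMapOfZero (F := G) (G := reflectObj F) ψ,
    tMap_comp_tMapOfZero (reflectDesc hG f) ψ h₁,
    tMapOfZero_comp_tMap (reflectDesc hG f) ψ h₂⟩

/-- The isomorphism between the presheaf represented by `A` and level `0` of `y A`. -/
def yonedaZeroPartIso (J : M ⥤ Q) (A : M) :
    CategoryTheory.yoneda.obj (show QOb J from A) ≅ ((CBar.yoneda J).obj A).zeroPart :=
  NatIso.ofComponents
    (fun X => (InducedCategory.homEquiv (X := X.unop) (Y := (show QOb J from A))).toIso)
    (fun _ => rfl)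

theorem yonedaZeroPartIso_naturality (J : M ⥤ Q) {A B : M} (f : A ⟶ B) :
    (yonedaZeroPartIso J A).hom ≫ zeroMap ((CBar.yoneda J).map f) =
      CategoryTheory.yoneda.map (InducedCategory.homMk (J.map f) :
        (show QOb J from A) ⟶ (show QOb J from B)) ≫ (yonedaZeroPartIso J B).hom := rfl

/-- If `J f` and `J g` exhibit a coproduct in `Q`, then `T` inverts the comparison
`L̃ (y A + y B) → y C`. -/
theorem exists_inverse_tMap_reflectDesc_yoneda {A B C : M} (f : A ⟶ C) (g : B ⟶ C)
    (h : IsColimit (BinaryCofan.mk (J.map f) (J.map g))) :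
    ∃ k, tMap (reflectDesc (smooth_yoneda J C)
        (coprodDesc ((CBar.yoneda J).map f) ((CBar.yoneda J).map g))) ≫ k = 𝟙 _ ∧
      k ≫ tMap (reflectDesc (smooth_yoneda J C)
        (coprodDesc ((CBar.yoneda J).map f) ((CBar.yoneda J).map g))) = 𝟙 _ := by
  refine exists_inverse_tMap_reflectDesc _ _ fun {P} hP φ => ?_
  let f' : (show QOb J from A) ⟶ (show QOb J from C) := InducedCategory.homMk (J.map f)
  let g' : (show QOb J from B) ⟶ (show QOb J from C) := InducedCategory.homMk (J.map g)
  -- `QOb J` is fully faithfully embedded in `Q`, so the coproduct is reflected.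
  have h' : IsColimit (BinaryCofan.mk f' g') :=
    isColimitOfReflectsOfMapIsColimit (inducedFunctor J.obj) f' g' h
  -- The restrictions of `φ` to the two summands, read as maps from representables, glue to a map
  -- from the representable of `C`.
  obtain ⟨m, ⟨hm₁, hm₂⟩, huniq⟩ := existsUnique_yoneda_hom hP h'
    ((yonedaZeroPartIso J A).hom ≫ zeroMap (coprodInl _ _) ≫ φ)
    ((yonedaZeroPartIso J B).hom ≫ zeroMap (coprodInr _ _) ≫ φ)
  refine ⟨(yonedaZeroPartIso J C).inv ≫ m, coprod_zeroPart_hom_ext ?_ ?_, ?_⟩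
  · rw [← cancel_epi (yonedaZeroPartIso J A).hom, ← hm₁]
    -- Injection followed by copairing is definitionally the corresponding component.
    change (yonedaZeroPartIso J A).hom ≫ zeroMap ((CBar.yoneda J).map f) ≫ _ ≫ _ = _
    rw [← Category.assoc, yonedaZeroPartIso_naturality, Category.assoc, Iso.hom_inv_id_assoc]
  · rw [← cancel_epi (yonedaZeroPartIso J B).hom, ← hm₂]
    change (yonedaZeroPartIso J B).hom ≫ zeroMap ((CBar.yoneda J).map g) ≫ _ ≫ _ = _
    rw [← Category.assoc, yonedaZeroPartIso_naturality, Category.assoc, Iso.hom_inv_id_assoc]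
  · rintro ψ rfl
    rw [Iso.eq_inv_comp]
    exact huniq _ ⟨rfl, rfl⟩

end CBar

/-! ### Copairing in the category of smooth functors. -/

namespace CTilde

variable {J : M ⥤ Q}

/-- The copairing out of the coproduct of smooth functors. -/
noncomputable def desc {F G H : CTilde J} (f : F ⟶ H) (g : G ⟶ H) : CTilde.coprod F G ⟶ H :=
  ObjectProperty.homMk (CBar.reflectDesc H.property (CBar.coprodDesc f.hom g.hom))

theorem inl_desc {F G H : CTilde J} (f : F ⟶ H) (g : G ⟶ H) : inl F G ≫ desc f g = f :=
  ObjectProperty.hom_ext _ ((Category.assoc _ _ _).trans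
    (congrArg (CBar.coprodInl F.obj G.obj ≫ ·)
      (CBar.reflectUnit_desc H.property (CBar.coprodDesc f.hom g.hom))))

theorem inr_desc {F G H : CTilde J} (f : F ⟶ H) (g : G ⟶ H) : inr F G ≫ desc f g = g :=
  ObjectProperty.hom_ext _ ((Category.assoc _ _ _).trans
    (congrArg (CBar.coprodInr F.obj G.obj ≫ ·)
      (CBar.reflectUnit_desc H.property (CBar.coprodDesc f.hom g.hom))))

/-- If `J f` and `J g` exhibit a coproduct in `Q`, then `T̃` inverts the copairing of `ȳ f` and
`ȳ g`. -/
theorem isIso_T_map_desc_lambek {A B C : M} (f : A ⟶ C) (g : B ⟶ C)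
    (h : IsColimit (BinaryCofan.mk (J.map f) (J.map g))) :
    IsIso ((T J).map (desc ((lambek J).map f) ((lambek J).map g))) := by
  obtain ⟨k, hk₁, hk₂⟩ := CBar.exists_inverse_tMap_reflectDesc_yoneda f g h
  exact ⟨ObjectProperty.homMk k, ObjectProperty.hom_ext _ hk₁, ObjectProperty.hom_ext _ hk₂⟩

end CTilde

end Model

/-! ### Inversion up to the unit of a monad, and the theorem itself. -/

/-- If a monad `T` inverts `f : X ⟶ Y`, then `f` has an inverse `Y ⟶ T X` up to the unit of `T`. -/
theorem exists_inverse_up_to_unit {D : Type*} [Category* D] (T : Monad D) {X Y : D} (f : X ⟶ Y)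
    [IsIso (T.map f)] :
    ∃ d : Y ⟶ T.obj X, d ≫ T.map f = T.η.app Y ∧ f ≫ d = T.η.app X := by
  refine ⟨T.η.app Y ≫ inv (T.map f), by simp, ?_⟩
  have h := T.η.naturality f
  rw [Functor.id_map] at h
  -- This is the naturality square of the unit at `f`, with `T.map f` moved across as an
  -- isomorphism.
  exact (Category.assoc _ _ _).symm.trans ((IsIso.comp_inv_eq _).2 h)

theorem mainTheorem2 {M Q : Type u} [SmallCategory M] [MonoidalCategory M] [SymmetricCategory M]
    [SmallCategory Q] [MonoidalCategory Q] [SymmetricCategory Q]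
    (J : M ⥤ Q) [J.Monoidal] (hJ : IsStrictMonoidal J) (hobj : Function.Bijective J.obj)
    (Bit : M) (zero one : 𝟙_ M ⟶ Bit)
    (inj₁ inj₂ : 𝟙_ Q ⟶ J.obj Bit)
    (hcoprod : Nonempty (IsColimit (BinaryCofan.mk inj₁ inj₂)))
    (hdistrib : ∀ A : Q, Nonempty (IsColimit (BinaryCofan.mk (A ◁ inj₁) (A ◁ inj₂))))
    (hzero : Functor.LaxMonoidal.ε J ≫ J.map zero = inj₁)
    (hone : Functor.LaxMonoidal.ε J ≫ J.map one = inj₂) :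
    Nonempty (IsColimit (BinaryCofan.mk ((lambekQ Q).map inj₁) ((lambekQ Q).map inj₂))) ∧
    ∃ (init : CTilde.bool J ⟶ (CTilde.lambek J).obj Bit)
      (Dyn : (CTilde.lambek J).obj Bit ⟶ (CTilde.T J).obj (CTilde.bool J)),
      CTilde.inl _ _ ≫ init = (CTilde.lambek J).map zero ∧
      CTilde.inr _ _ ≫ init = (CTilde.lambek J).map one ∧
      IsIso ((CTilde.T J).map init) ∧
      Dyn ≫ (CTilde.T J).map init = (CTilde.T J).η.app ((CTilde.lambek J).obj Bit) ∧
      init ≫ Dyn = (CTilde.T J).η.app (CTilde.bool J) := by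
  obtain ⟨hc⟩ := hcoprod
  refine ⟨nonempty_isColimit_lambekQ hc, ?_⟩
  -- `J.map zero` and `J.map one` start at `J.obj (𝟙_ M)`, while the injections start at `𝟙_ Q`.
  -- Precomposing both legs with the inverse of `ε` keeps the coproduct and cancels the `ε` in
  -- `hzero` and `hone`.
  have hc' : IsColimit (BinaryCofan.mk (J.map zero) (J.map one)) := by
    have h : IsColimit (BinaryCofan.mk (inv (Functor.LaxMonoidal.ε J) ≫ inj₁)
        (inv (Functor.LaxMonoidal.ε J) ≫ inj₂)) :=
      BinaryCofan.isColimitCompRightIso _ (inv (Functor.LaxMonoidal.ε J))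
        (BinaryCofan.isColimitCompLeftIso _ (inv (Functor.LaxMonoidal.ε J)) hc)
    rwa [← hzero, ← hone, IsIso.inv_hom_id_assoc, IsIso.inv_hom_id_assoc] at h
  have := CTilde.isIso_T_map_desc_lambek zero one hc'
  obtain ⟨Dyn, h₁, h₂⟩ := exists_inverse_up_to_unit (CTilde.T J)
    (CTilde.desc ((CTilde.lambek J).map zero) ((CTilde.lambek J).map one))
  exact ⟨_, Dyn, CTilde.inl_desc _ _, CTilde.inr_desc _ _, this, h₁, h₂⟩
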